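/- Let $d\in\mathbb N$ and let $\lambda,\Lambda,\mathfrak r>0$. For a $d\times d$ real matrix $a$ put $\|a\|=\sum_{i,j}|a_{ij}|$. Let $\Omega_{\mathfrak r}$ be the set of all continuously differentiable maps $\omega$ from $\mathbb R^d$ to the real symmetric $d\times d$ matrices such that, for every $x\in\mathbb R^d$, the matrix $\omega(x)-\mathfrak r I_d$ is non-negative definite, $\|\omega(x)\|\le\Lambda$ and $\operatorname{Tr}\omega(x)\ge\lambda$. Equip $\Omega_{\mathfrak r}$ with the metric $$d_{\mathfrak r}(\omega_1,\omega_2)=\sum_{K=1}^\infty \frac1{2^K}\,\frac{\|\omega_1-\omega_2\|_{1,\infty,K}}{1+\|\omega_1-\omega_2\|_{1,\infty,K}},\qquad \|f\|_{1,\infty,K}=\sup_{|x|\le K}\|f(x)\|+\sup_{|x|\le K}|\nabla f(x)|,$$ where $|\nabla f(x)|=\sum_{i,j}|\nabla f_{ij}(x)|$, and with its Borel $\sigma$-field $\mathcal B(\Omega_{\mathfrak r})$. For $x\in\mathbb R^d$ let $(\tau_x\omega)(y)=\omega(x+y)$. Let $\mu$ be a probability measure on $(\Omega_{\mathfrak r},\mathcal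 B(\Omega_{\mathfrak r}))$ that is invariant under the translations, i.e. $(\tau_x)_\sharp\mu=\mu$ for all $x\in\mathbb R^d$, and ergodic, i.e. $\mu(A)\in\{0,1\}$ for every $A\in\mathcal B(\Omega_{\mathfrak r})$ with $\tau_xA=A$ for all $x\in\mathbb R^d$. Then there exist a sequence $(\omega_n)_{n\in\mathbb N}$ in $\Omega_{\mathfrak r}$ and a strictly increasing sequence $(M_n)_{n\in\mathbb N}$ of positive real numbers with $M_n\to\infty$ such that 1. each $\omega_n$ is $M_n$-periodic in each variable, i.e. $\tau_{M_n e_i}\omega_n=\omega_n$ for $i=1,\dots,d$, where $e_1,\dots,e_d$ is the canonical basis of $\mathbb R^d$; 2. the formula $$\mu_n(A)=\frac1{M_n^d}\int_{[-M_n/2,\,M_n/2]^d}\mathbf 1_A(\tau_y\omega_n)\,dy,\qquad A\in\mathcal B(\Omega_{\mathfrak r})$$ (the integral over the torus $\mathbb T^d_{M_n}$ of side length $M_n$ with respect to its normalized Lebesgue measure), defines a probability measure for each $n$, and $\mu_n$ converges weakly to $\mu$ as $n\to\infty$, i.e. for every bounded continuous function $F:\Omega_{\mathfrak r}\to\mathbb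 R$, $$\lim_{n\to\infty}\int_{\Omega_{\mathfrak r}}F\,d\mu_n=\int_{\Omega_{\mathfrak r}}F\,d\mu .$$ -/

import Mathlib

open MeasureTheory Filter Topology

noncomputable section

namespace StableLike

/-- The Euclidean space `ℝ^d`. -/
abbrev Space (d : ℕ) : Type := EuclideanSpace ℝ (Fin d)

/-- The norm `‖a‖ = ∑ᵢⱼ |aᵢⱼ|` of a matrix. -/
def matNorm {d : ℕ} (a : Matrix (Fin d) (Fin d) ℝ) : ℝ := ∑ i, ∑ j, |a i j|

/-- The size `|∇f(x)| = ∑ᵢⱼ |∇fᵢⱼ(x)|` of the gradient of a matrix valued function. -/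
def gradNorm {d : ℕ} (f : Space d → Matrix (Fin d) (Fin d) ℝ) (x : Space d) : ℝ :=
  ∑ i, ∑ j, ‖fderiv ℝ (fun z => f z i j) x‖

/-- The seminorm `‖f‖_{1,∞,K} = sup_{|x| ≤ K} |f(x)| + sup_{|x| ≤ K} |∇f(x)|`. -/
def c1Norm {d : ℕ} (K : ℕ) (f : Space d → Matrix (Fin d) (Fin d) ℝ) : ℝ :=
  (⨆ x : Metric.closedBall (0 : Space d) K, matNorm (f x)) +
    ⨆ x : Metric.closedBall (0 : Space d) K, gradNorm f x

/-- The space `Ω_r` of regular, uniformly elliptic environments: `C¹` functions from `ℝ^d` into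
the symmetric matrices `a` with `a - r I` non-negative definite, `‖a‖ ≤ Lam` and `Tr a ≥ lam`. -/
@[ext]
structure Env (d : ℕ) (lam Lam r : ℝ) where
  toFun : Space d → Matrix (Fin d) (Fin d) ℝ
  contDiff_entry : ∀ i j, ContDiff ℝ 1 (fun x => toFun x i j)
  elliptic : ∀ x, (toFun x - r • (1 : Matrix (Fin d) (Fin d) ℝ)).PosSemidef
  norm_le : ∀ x, matNorm (toFun x) ≤ Lam
  le_trace : ∀ x, lam ≤ (toFun x).trace

/-- The Fréchet metric
`d_r(ω₁, ω₂) = ∑_{K ≥ 1} 2^{-K} ‖ω₁ - ω₂‖_{1,∞,K} / (1 + ‖ω₁ - ω₂‖_{1,∞,K})`. -/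
def frechetDist {d : ℕ} {lam Lam r : ℝ} (ω₁ ω₂ : Env d lam Lam r) : ℝ :=
  ∑' k : ℕ, (1 / 2 ^ (k + 1) : ℝ) *
    (c1Norm (k + 1) (ω₁.toFun - ω₂.toFun) / (1 + c1Norm (k + 1) (ω₁.toFun - ω₂.toFun)))

section MetricFacts

variable {d : ℕ}

/-- Entrywise `C¹` matrix valued functions. -/
def IsC1 (f : Space d → Matrix (Fin d) (Fin d) ℝ) : Prop :=
  ∀ i j, ContDiff ℝ 1 (fun x => f x i j)

theorem IsC1.sub {f g : Space d → Matrix (Fin d) (Fin d) ℝ} (hf : IsC1 f) (hg : IsC1 g) :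
    IsC1 (f - g) := fun i j => (hf i j).sub (hg i j)

theorem matNorm_nonneg (a : Matrix (Fin d) (Fin d) ℝ) : 0 ≤ matNorm a := by
  unfold matNorm; positivity

theorem gradNorm_nonneg (f : Space d → Matrix (Fin d) (Fin d) ℝ) (x : Space d) :
    0 ≤ gradNorm f x := by
  unfold gradNorm; positivity

theorem matNorm_add_le (a b : Matrix (Fin d) (Fin d) ℝ) :
    matNorm (a + b) ≤ matNorm a + matNorm b := by
  unfold matNorm
  rw [← Finset.sum_add_distrib]
  refine Finset.sum_le_sum fun i _ => ?_
  rw [← Finset.sum_add_distrib]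
  exact Finset.sum_le_sum fun j _ => abs_add_le _ _

theorem gradNorm_add_le {f g : Space d → Matrix (Fin d) (Fin d) ℝ} (hf : IsC1 f) (hg : IsC1 g)
    (x : Space d) : gradNorm (f + g) x ≤ gradNorm f x + gradNorm g x := by
  unfold gradNorm
  rw [← Finset.sum_add_distrib]
  refine Finset.sum_le_sum fun i _ => ?_
  rw [← Finset.sum_add_distrib]
  refine Finset.sum_le_sum fun j _ => ?_
  have h1 : DifferentiableAt ℝ (fun z => f z i j) x := (hf i j).differentiable one_ne_zero x
  have h2 : DifferentiableAt ℝ (fun z => g z i j) x := (hg i j).differentiable one_ne_zero x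
  have h3 : fderiv ℝ (fun z => (f + g) z i j) x
      = fderiv ℝ (fun z => f z i j) x + fderiv ℝ (fun z => g z i j) x := fderiv_add h1 h2
  rw [h3]
  exact norm_add_le _ _

theorem continuous_matNorm {f : Space d → Matrix (Fin d) (Fin d) ℝ} (hf : IsC1 f) :
    Continuous fun x => matNorm (f x) :=
  continuous_finsetSum _ fun i _ => continuous_finsetSum _ fun j _ => (hf i j).continuous.abs

theorem continuous_gradNorm {f : Space d → Matrix (Fin d) (Fin d) ℝ} (hf : IsC1 f) :
    Continuous fun x => gradNorm f x :=
  continuous_finsetSum _ fun i _ => continuous_finsetSum _ fun j _ =>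
    ((hf i j).continuous_fderiv one_ne_zero).norm

theorem bddAbove_ball {h : Space d → ℝ} (hh : Continuous h) (K : ℕ) :
    BddAbove (Set.range fun x : Metric.closedBall (0 : Space d) K => h x) := by
  have := (isCompact_closedBall (0 : Space d) K).bddAbove_image hh.continuousOn
  rwa [Set.image_eq_range] at this

instance (K : ℕ) : Nonempty (Metric.closedBall (0 : Space d) K) := ⟨⟨0, by simp⟩⟩

theorem c1Norm_nonneg (K : ℕ) (f : Space d → Matrix (Fin d) (Fin d) ℝ) : 0 ≤ c1Norm K f :=
  add_nonneg (Real.iSup_nonneg fun _ => matNorm_nonneg _)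
    (Real.iSup_nonneg fun _ => gradNorm_nonneg _ _)

theorem c1Norm_add_le (K : ℕ) {f g : Space d → Matrix (Fin d) (Fin d) ℝ} (hf : IsC1 f)
    (hg : IsC1 g) : c1Norm K (f + g) ≤ c1Norm K f + c1Norm K g := by
  have h1 : (⨆ x : Metric.closedBall (0 : Space d) K, matNorm ((f + g) x)) ≤
      (⨆ x : Metric.closedBall (0 : Space d) K, matNorm (f x)) +
        ⨆ x : Metric.closedBall (0 : Space d) K, matNorm (g x) :=
    ciSup_le fun x => (matNorm_add_le _ _).trans
      (add_le_add (le_ciSup (bddAbove_ball (continuous_matNorm hf) K) x)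
        (le_ciSup (bddAbove_ball (continuous_matNorm hg) K) x))
  have h2 : (⨆ x : Metric.closedBall (0 : Space d) K, gradNorm (f + g) x) ≤
      (⨆ x : Metric.closedBall (0 : Space d) K, gradNorm f x) +
        ⨆ x : Metric.closedBall (0 : Space d) K, gradNorm g x :=
    ciSup_le fun x => (gradNorm_add_le hf hg _).trans
      (add_le_add (le_ciSup (bddAbove_ball (continuous_gradNorm hf) K) x)
        (le_ciSup (bddAbove_ball (continuous_gradNorm hg) K) x))
  unfold c1Norm
  linarith

theorem c1Norm_neg (K : ℕ) (f : Space d → Matrix (Fin d) (Fin d) ℝ) :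
    c1Norm K (-f) = c1Norm K f := by
  have h1 : ∀ x, matNorm ((-f) x) = matNorm (f x) := fun x => by simp [matNorm]
  have h2 : ∀ x, gradNorm (-f) x = gradNorm f x := fun x => by
    unfold gradNorm
    refine Finset.sum_congr rfl fun i _ => Finset.sum_congr rfl fun j _ => ?_
    have : fderiv ℝ (fun z => (-f) z i j) x = -fderiv ℝ (fun z => f z i j) x := by
      simp
    rw [this, norm_neg]
  simp only [c1Norm, h1, h2]

theorem c1Norm_zero (K : ℕ) : c1Norm K (0 : Space d → Matrix (Fin d) (Fin d) ℝ) = 0 := by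
  simp [c1Norm, matNorm, gradNorm]

theorem matNorm_le_c1Norm {K : ℕ} {f : Space d → Matrix (Fin d) (Fin d) ℝ} (hf : IsC1 f)
    {x : Space d} (hx : ‖x‖ ≤ K) : matNorm (f x) ≤ c1Norm K f := by
  have h := le_ciSup (bddAbove_ball (continuous_matNorm hf) K) ⟨x, by simpa using hx⟩
  have h' : (0 : ℝ) ≤ ⨆ x : Metric.closedBall (0 : Space d) K, gradNorm f x :=
    Real.iSup_nonneg fun _ => gradNorm_nonneg _ _
  unfold c1Norm
  linarith

theorem frac_le_one {t : ℝ} (ht : 0 ≤ t) : t / (1 + t) ≤ 1 := by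
  rw [div_le_one (by linarith)]; linarith

theorem frac_mono {s t : ℝ} (hs : 0 ≤ s) (h : s ≤ t) : s / (1 + s) ≤ t / (1 + t) := by
  rw [div_le_div_iff₀ (by linarith) (by linarith)]; nlinarith

theorem frac_add_le {s t : ℝ} (hs : 0 ≤ s) (ht : 0 ≤ t) :
    (s + t) / (1 + (s + t)) ≤ s / (1 + s) + t / (1 + t) := by
  rw [add_div]
  gcongr <;> linarith

theorem summable_half : Summable fun k : ℕ => (1 / 2 ^ (k + 1) : ℝ) := by
  have := (summable_geometric_two).mul_left (1 / 2)
  refine this.congr fun k => ?_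
  rw [pow_succ, one_div_pow]; ring

theorem summable_term (f : Space d → Matrix (Fin d) (Fin d) ℝ) :
    Summable fun k : ℕ => (1 / 2 ^ (k + 1) : ℝ) * (c1Norm (k + 1) f / (1 + c1Norm (k + 1) f)) := by
  refine Summable.of_nonneg_of_le (fun k => ?_) (fun k => ?_) summable_half
  · have := c1Norm_nonneg (k + 1) f
    positivity
  · exact mul_le_of_le_one_right (by positivity) (frac_le_one (c1Norm_nonneg _ _))

end MetricFacts

variable {d : ℕ} {lam Lam r : ℝ}

instance : MetricSpace (Env d lam Lam r) where
  dist := frechetDist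
  dist_self ω := by simp [frechetDist, c1Norm_zero]
  dist_comm ω₁ ω₂ := by
    have h : ∀ K, c1Norm K (ω₁.toFun - ω₂.toFun) = c1Norm K (ω₂.toFun - ω₁.toFun) := fun K => by
      rw [← c1Norm_neg, neg_sub]
    simp only [frechetDist, h]
  dist_triangle ω₁ ω₂ ω₃ := by
    unfold frechetDist
    rw [← (summable_term _).tsum_add (summable_term _)]
    refine (summable_term _).tsum_le_tsum (fun k => ?_)
      ((summable_term _).add (summable_term _))
    rw [← mul_add]
    refine mul_le_mul_of_nonneg_left ?_ (by positivity)
    have h : ω₁.toFun - ω₃.toFun = (ω₁.toFun - ω₂.toFun) + (ω₂.toFun - ω₃.toFun) := by abel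
    have h12 : IsC1 (ω₁.toFun - ω₂.toFun) :=
      IsC1.sub ω₁.contDiff_entry ω₂.contDiff_entry
    have h23 : IsC1 (ω₂.toFun - ω₃.toFun) :=
      IsC1.sub ω₂.contDiff_entry ω₃.contDiff_entry
    rw [h]
    exact (frac_mono (c1Norm_nonneg _ _) (c1Norm_add_le _ h12 h23)).trans
      (frac_add_le (c1Norm_nonneg _ _) (c1Norm_nonneg _ _))
  eq_of_dist_eq_zero := by
    intro ω₁ ω₂ h0
    change frechetDist ω₁ ω₂ = 0 at h0
    have hn : ∀ k : ℕ, 0 ≤ (1 / 2 ^ (k + 1) : ℝ) * (c1Norm (k + 1) (ω₁.toFun - ω₂.toFun) /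
        (1 + c1Norm (k + 1) (ω₁.toFun - ω₂.toFun))) := fun k => by
      have := c1Norm_nonneg (k + 1) (ω₁.toFun - ω₂.toFun)
      positivity
    unfold frechetDist at h0
    have h1 := (summable_term (ω₁.toFun - ω₂.toFun)).hasSum
    rw [h0, hasSum_zero_iff_of_nonneg hn] at h1
    have h2 : ∀ k : ℕ, c1Norm (k + 1) (ω₁.toFun - ω₂.toFun) = 0 := fun k => by
      have h3 := congrFun h1 k
      have h4 := c1Norm_nonneg (k + 1) (ω₁.toFun - ω₂.toFun)
      simp only [Pi.zero_apply, mul_eq_zero, div_eq_zero_iff] at h3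
      rcases h3 with h3 | h3 | h3
      · rcases h3 with h3 | h3
        · exact absurd h3 one_ne_zero
        · exact absurd h3 (pow_ne_zero _ two_ne_zero)
      · exact h3
      · linarith
    ext x i j
    obtain ⟨k, hk⟩ := exists_nat_ge ‖x‖
    have h5 : matNorm ((ω₁.toFun - ω₂.toFun) x) ≤ 0 := by
      rw [← h2 k]
      refine matNorm_le_c1Norm (IsC1.sub ω₁.contDiff_entry ω₂.contDiff_entry) ?_
      push_cast
      linarith
    have h6 : |(ω₁.toFun - ω₂.toFun) x i j| ≤ matNorm ((ω₁.toFun - ω₂.toFun) x) :=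
      (Finset.single_le_sum (f := fun j => |(ω₁.toFun - ω₂.toFun) x i j|)
        (fun _ _ => abs_nonneg _) (Finset.mem_univ j)).trans
      (Finset.single_le_sum (f := fun i => ∑ j, |(ω₁.toFun - ω₂.toFun) x i j|)
        (fun _ _ => Finset.sum_nonneg fun _ _ => abs_nonneg _) (Finset.mem_univ i))
    have h7 := abs_nonpos_iff.1 (h6.trans h5)
    simpa [sub_eq_zero] using h7

/-- The Borel `σ`-field of `(Ω_r, d_r)`. -/
instance : MeasurableSpace (Env d lam Lam r) := borel _

instance : BorelSpace (Env d lam Lam r) := ⟨rfl⟩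

/-- The translations `(τ_x ω)(y) = ω(x + y)`. -/
def Env.shift (x : Space d) (ω : Env d lam Lam r) : Env d lam Lam r where
  toFun y := ω.toFun (x + y)
  contDiff_entry i j := (ω.contDiff_entry i j).comp (contDiff_const.add contDiff_id)
  elliptic y := ω.elliptic (x + y)
  norm_le y := ω.norm_le (x + y)
  le_trace y := ω.le_trace (x + y)

/-- `μ` is invariant under all translations: `(τ_x)_♯ μ = μ` for every `x`. -/
def IsShiftInvariant (μ : Measure (Env d lam Lam r)) : Prop :=
  ∀ x : Space d, μ.map (Env.shift x) = μ

/-- Every Borel set `A` with `τ_x A = A` for all `x` has `μ`-measure `0` or `1`. -/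
def IsShiftErgodic (μ : Measure (Env d lam Lam r)) : Prop :=
  ∀ A : Set (Env d lam Lam r), MeasurableSet A → (∀ x : Space d, Env.shift x '' A = A) →
    μ A = 0 ∨ μ A = 1

/-- `ω` is `M`-periodic in each variable: `τ_{M e_i} ω = ω` for all `i`. -/
def Env.IsPeriodic (M : ℝ) (ω : Env d lam Lam r) : Prop :=
  ∀ i : Fin d, Env.shift (EuclideanSpace.single i M) ω = ω

/-- The cube `Q_M = [-M/2, M/2]^d`. With opposite faces identified it is the torus `𝕋^d_M`. -/
def cube (d : ℕ) (M : ℝ) : Set (Space d) := {y | ∀ i, y i ∈ Set.Icc (-M / 2) (M / 2)}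

/-- The normalized Lebesgue measure `ℓ_M(dy) = M^{-d} dy` on `Q_M` (equivalently on the torus
`𝕋^d_M`, the boundary of the cube being negligible). -/
def cubeMeasure (d : ℕ) (M : ℝ) : Measure (Space d) :=
  ENNReal.ofReal ((M ^ d)⁻¹) • volume.restrict (cube d M)

/-- The empirical measure `A ↦ ∫ 1_A(τ_y ω) ℓ_M(dy)` on `Ω_r`, as the image of `ℓ_M` under the
(continuous) map `y ↦ τ_y ω`; the integral formula is `empiricalMeasure_apply` below. -/
def empiricalMeasure (M : ℝ) (ω : Env d lam Lam r) : Measure (Env d lam Lam r) :=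
  (cubeMeasure d M).map fun y => Env.shift y ω

theorem tendsto_iSup_ball {h : Space d → Space d → ℝ} (hh : Continuous fun p : Space d × Space d =>
    h p.1 p.2) (hn : ∀ y x, 0 ≤ h y x) (y₀ : Space d) (h0 : ∀ x, h y₀ x = 0) (K : ℕ) :
    Tendsto (fun y => ⨆ x : Metric.closedBall (0 : Space d) K, h y x) (𝓝 y₀) (𝓝 0) := by
  rw [Metric.tendsto_nhds]
  intro ε hε
  have key : ∀ᶠ y in 𝓝 y₀, ∀ x ∈ Metric.closedBall (0 : Space d) K, h y x < ε / 2 := by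
    refine (isCompact_closedBall (0 : Space d) K).eventually_forall_of_forall_eventually ?_
    intro x _
    refine (hh.tendsto (y₀, x)).eventually_lt_const ?_
    simp only [h0]
    linarith
  filter_upwards [key] with y hy
  have h1 : (⨆ x : Metric.closedBall (0 : Space d) K, h y x) ≤ ε / 2 :=
    ciSup_le fun x => (hy x x.2).le
  have h2 : 0 ≤ ⨆ x : Metric.closedBall (0 : Space d) K, h y x := Real.iSup_nonneg fun x => hn y x
  rw [Real.dist_eq, sub_zero, abs_of_nonneg h2]
  linarith

theorem continuous_shift (ω : Env d lam Lam r) : Continuous fun y => Env.shift y ω := by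
  rw [continuous_iff_continuousAt]
  intro y₀
  have hc : ∀ K : ℕ, Tendsto
      (fun y => c1Norm K ((Env.shift y ω).toFun - (Env.shift y₀ ω).toFun)) (𝓝 y₀) (𝓝 0) := by
    intro K
    have h1 := tendsto_iSup_ball (d := d)
      (h := fun y x => matNorm (ω.toFun (y + x) - ω.toFun (y₀ + x))) ?_
      (fun _ _ => matNorm_nonneg _) y₀ (by simp [matNorm]) K
    have hg : ∀ y x, gradNorm ((Env.shift y ω).toFun - (Env.shift y₀ ω).toFun) x =
        ∑ i, ∑ j, ‖fderiv ℝ (fun z => ω.toFun z i j) (y + x) -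
          fderiv ℝ (fun z => ω.toFun z i j) (y₀ + x)‖ := by
      intro y x
      unfold gradNorm
      refine Finset.sum_congr rfl fun i _ => Finset.sum_congr rfl fun j _ => ?_
      have e : fderiv ℝ (fun z => ((Env.shift y ω).toFun - (Env.shift y₀ ω).toFun) z i j) x
          = fderiv ℝ (fun z => ω.toFun (y + z) i j) x -
            fderiv ℝ (fun z => ω.toFun (y₀ + z) i j) x :=
        fderiv_sub (((Env.shift y ω).contDiff_entry i j).differentiable one_ne_zero x)
          (((Env.shift y₀ ω).contDiff_entry i j).differentiable one_ne_zero x)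
      rw [e, fderiv_comp_add_left (f := fun z => ω.toFun z i j),
        fderiv_comp_add_left (f := fun z => ω.toFun z i j)]
    have h2 := tendsto_iSup_ball (d := d)
      (h := fun y x => gradNorm ((Env.shift y ω).toFun - (Env.shift y₀ ω).toFun) x) ?_
      (fun _ _ => gradNorm_nonneg _ _) y₀ (by simp [gradNorm]) K
    · simpa [c1Norm, Env.shift] using h1.add h2
    · simp only [hg]
      refine continuous_finsetSum _ fun i _ => continuous_finsetSum _ fun j _ => ?_
      have := (ω.contDiff_entry i j).continuous_fderiv one_ne_zero
      fun_prop
    · refine continuous_finsetSum _ fun i _ => continuous_finsetSum _ fun j _ => ?_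
      have := (ω.contDiff_entry i j).continuous
      exact ((this.comp (by fun_prop : Continuous fun p : Space d × Space d => p.1 + p.2)).sub
        (this.comp (by fun_prop : Continuous fun p : Space d × Space d => y₀ + p.2))).abs
  rw [ContinuousAt, tendsto_iff_dist_tendsto_zero]
  have h := tendsto_tsum_of_dominated_convergence (𝓕 := 𝓝 y₀)
    (f := fun y (k : ℕ) => (1 / 2 ^ (k + 1) : ℝ) *
      (c1Norm (k + 1) ((Env.shift y ω).toFun - (Env.shift y₀ ω).toFun) /
        (1 + c1Norm (k + 1) ((Env.shift y ω).toFun - (Env.shift y₀ ω).toFun))))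
    (g := fun _ => 0) (bound := fun k : ℕ => (1 / 2 ^ (k + 1) : ℝ)) summable_half ?_ ?_
  · rw [tsum_zero] at h
    exact h
  · intro k
    have h1 := hc (k + 1)
    have h2 : Tendsto (fun t : ℝ => (1 / 2 ^ (k + 1) : ℝ) * (t / (1 + t))) (𝓝 0) (𝓝 0) := by
      have : ContinuousAt (fun t : ℝ => (1 / 2 ^ (k + 1) : ℝ) * (t / (1 + t))) 0 := by
        fun_prop (disch := norm_num)
      simpa [ContinuousAt] using this
    exact h2.comp h1
  · refine Eventually.of_forall fun y k => ?_
    have hn := c1Norm_nonneg (k + 1) ((Env.shift y ω).toFun - (Env.shift y₀ ω).toFun)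
    rw [Real.norm_of_nonneg (by positivity)]
    exact mul_le_of_le_one_right (by positivity) (frac_le_one hn)

theorem empiricalMeasure_apply (M : ℝ) (ω : Env d lam Lam r) {A : Set (Env d lam Lam r)}
    (hA : MeasurableSet A) :
    empiricalMeasure M ω A = ∫⁻ y, A.indicator 1 (Env.shift y ω) ∂cubeMeasure d M := by
  rw [empiricalMeasure, ← lintegral_indicator_one hA,
    lintegral_map (measurable_one.indicator hA) (continuous_shift ω).measurable]

theorem volume_cube {M : ℝ} : volume (cube d M) = ENNReal.ofReal M ^ d := by
  have hc : cube d M = (MeasurableEquiv.toLp 2 (Fin d → ℝ)).symm ⁻¹'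
      (Set.univ.pi fun _ : Fin d => Set.Icc (-M / 2) (M / 2)) := by
    ext y; rw [Set.mem_preimage, Set.mem_univ_pi]; rfl
  rw [hc, (EuclideanSpace.volume_preserving_symm_measurableEquiv_toLp
    (Fin d)).measure_preimage_equiv, volume_pi_pi]
  simp only [Real.volume_Icc, Finset.prod_const, Finset.card_univ, Fintype.card_fin]
  congr 2
  ring

theorem isProbabilityMeasure_empiricalMeasure {M : ℝ} (hM : 0 < M) (ω : Env d lam Lam r) :
    IsProbabilityMeasure (empiricalMeasure M ω) := by
  refine ⟨?_⟩
  rw [empiricalMeasure, Measure.map_apply (continuous_shift ω).measurable MeasurableSet.univ]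
  simp only [Set.preimage_univ, cubeMeasure, Measure.smul_apply, Measure.restrict_apply_univ,
    volume_cube, smul_eq_mul]
  rw [← ENNReal.ofReal_pow hM.le, ← ENNReal.ofReal_mul (by positivity),
    inv_mul_cancel₀ (by positivity), ENNReal.ofReal_one]

end StableLike

end

/-!
The law `μ` is approximated in two independent steps.

*Ergodic averages.* The translations form a measurable, `μ`-preserving action of `ℝ^d`, and the
empirical measure of an arbitrary environment `ω` on the cube of side `m` integrates `F` to the
orbit average `cubeAverage d m F ω`. By the mean ergodic theorem
(`tendsto_lintegral_enorm_cubeAverage_sub`) these averages converge to `∫ F ∂μ` in `L¹(μ)` for every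
bounded measurable `F`. Hence, given finitely many bounded continuous functions and a large `m`,
there is an environment whose averages are close to the `μ`-integrals of all of them at once. Since
the space of environments is separable, the weak topology is metrizable, and a countable basis of
neighbourhoods of `μ` yields environments `ω n` and side lengths `M n` whose empirical measures
converge weakly to `μ`. The mean ergodic theorem itself is von Neumann's argument: bounded
coboundaries `G ∘ τ_x - G` have uniformly vanishing averages, and together with the constants they
are dense in `L²(μ)`, since a function orthogonal to all coboundaries is invariant
(`convergenceSubspace_orthogonal_eq_bot`). Ergodicity is given for strictly invariant Borel sets
only; `ergodicVAdd_of_forall_invariant` extends it to sets that are invariant up to null sets.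

*Periodization.* There is a `C¹` function `h : ℝ → ℝ` of period `m` that is the identity on
`[-(m/2 - L), m/2 - L]`. Composing `ω` with `h` applied to each coordinate gives an `m`-periodic
environment: the defining constraints are pointwise, so they survive without any loss. It agrees
with `ω` on a cube that is only slightly smaller, and the metric only sees environments near the
origin up to a small error, so `τ_y` of the two environments are close for all `y` outside a thin
boundary layer (`exists_isPeriodic_dist_shift_le`). Integrals of bounded Lipschitz functions against
the two empirical measures are therefore close, and such functions determine weak convergence.
-/

namespace StableLike

open scoped ENNReal

/-! ### Averages over large cubes -/

section Cubes

variable {d : ℕ} {m c : ℝ}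

theorem measurableSet_cube : MeasurableSet (cube d m) := by
  have h : cube d m = ⋂ i, (fun y : Space d => y i) ⁻¹' Set.Icc (-m / 2) (m / 2) := by
    ext y
    simp only [cube, Set.mem_iInter, Set.mem_preimage, Set.mem_ofPred_eq]
  rw [h]
  exact MeasurableSet.iInter fun i =>
    (isClosed_Icc.preimage (by fun_prop : Continuous fun y : Space d => y i)).measurableSet

theorem mem_cube_iff_abs {y : Space d} : y ∈ cube d m ↔ ∀ i, |y i| ≤ m / 2 := by
  simp only [cube, Set.mem_ofPred_eq, Set.mem_Icc, abs_le, neg_div]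

theorem cube_sub_subset (hc : 0 ≤ c) : cube d (m - c) ⊆ cube d m := fun y hy => by
  rw [mem_cube_iff_abs] at hy ⊢
  exact fun i => (hy i).trans (by linarith)

theorem add_mem_cube {x y : Space d} (hx : 2 * ‖x‖ ≤ c) (hy : y ∈ cube d (m - c)) :
    y + x ∈ cube d m := by
  rw [mem_cube_iff_abs] at hy ⊢
  intro i
  have h1 : |x i| ≤ ‖x‖ := PiLp.norm_apply_le x i
  calc |(y + x) i| ≤ |y i| + |x i| := abs_add_le _ _
    _ ≤ m / 2 := by linarith [hy i]

theorem cubeMeasure_cube_sub (hm : 0 < m) (hc : 0 ≤ c) (hcm : c ≤ m) :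
    cubeMeasure d m (cube d (m - c)) = ENNReal.ofReal (((m - c) / m) ^ d) := by
  rw [cubeMeasure, Measure.smul_apply, Measure.restrict_apply measurableSet_cube,
    Set.inter_eq_self_of_subset_left (cube_sub_subset hc), volume_cube, smul_eq_mul,
    ← ENNReal.ofReal_pow (by linarith), ← ENNReal.ofReal_mul (by positivity), div_pow]
  congr 1
  field_simp

theorem isProbabilityMeasure_cubeMeasure (hm : 0 < m) :
    IsProbabilityMeasure (cubeMeasure d m) := by
  refine ⟨?_⟩
  rw [cubeMeasure, Measure.smul_apply, Measure.restrict_apply_univ, volume_cube, smul_eq_mul,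
    ← ENNReal.ofReal_pow hm.le, ← ENNReal.ofReal_mul (by positivity),
    inv_mul_cancel₀ (by positivity), ENNReal.ofReal_one]

instance : IsFiniteMeasure (cubeMeasure d m) := by
  refine ⟨?_⟩
  rw [cubeMeasure, Measure.smul_apply, Measure.restrict_apply_univ, volume_cube, smul_eq_mul]
  exact ENNReal.mul_lt_top ENNReal.ofReal_lt_top (ENNReal.pow_lt_top ENNReal.ofReal_lt_top)

/-- A boundary layer of fixed width occupies a vanishing fraction of a large cube. -/
theorem tendsto_cubeMeasure_compl (hc : 0 ≤ c) :
    Tendsto (fun m => (cubeMeasure d m).real (cube d (m - c))ᶜ) atTop (𝓝 0) := by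
  have h1 : Tendsto (fun m : ℝ => 1 - (1 - c / m) ^ d) atTop (𝓝 0) := by
    have := (((tendsto_const_nhds (x := c)).div_atTop tendsto_id).const_sub 1).pow d |>.const_sub 1
    simpa using this
  refine h1.congr' ?_
  filter_upwards [eventually_gt_atTop 0, eventually_ge_atTop c] with m hm hcm
  have := isProbabilityMeasure_cubeMeasure (d := d) hm
  rw [probReal_compl_eq_one_sub measurableSet_cube, Measure.real, cubeMeasure_cube_sub hm hc hcm,
    ENNReal.toReal_ofReal (pow_nonneg (div_nonneg (by linarith) hm.le) _), sub_div,
    div_self hm.ne']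

/-- Two probability measures that agree on a set of almost full mass give almost the same integral
to a bounded function. -/
theorem abs_integral_sub_integral_le_of_restrict_eq {α : Type*} [MeasurableSpace α]
    {ν₁ ν₂ : Measure α} [IsProbabilityMeasure ν₁] [IsProbabilityMeasure ν₂] {s : Set α}
    (hs : MeasurableSet s) (h : ν₁.restrict s = ν₂.restrict s) {f : α → ℝ} (hf : Measurable f)
    {C : ℝ} (hC : ∀ x, |f x| ≤ C) :
    |∫ x, f x ∂ν₁ - ∫ x, f x ∂ν₂| ≤ 2 * C * ν₂.real sᶜ := by
  have hi : ∀ ν : Measure α, [IsProbabilityMeasure ν] → Integrable f ν := fun ν _ =>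
    Integrable.of_bound hf.aestronglyMeasurable C (Eventually.of_forall hC)
  have hcompl : ν₁.real sᶜ = ν₂.real sᶜ := by
    rw [probReal_compl_eq_one_sub hs, probReal_compl_eq_one_sub hs, Measure.real, Measure.real,
      ← Measure.restrict_apply_self, h, Measure.restrict_apply_self]
  rw [← integral_add_compl hs (hi ν₁), ← integral_add_compl hs (hi ν₂), h, add_sub_add_left_eq_sub]
  have h1 := norm_setIntegral_le_of_norm_le_const (f := f) (s := sᶜ) (μ := ν₁) (C := C)
    (measure_lt_top _ _) (fun x _ => hC x)
  have h2 := norm_setIntegral_le_of_norm_le_const (f := f) (s := sᶜ) (μ := ν₂) (C := C)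
    (measure_lt_top _ _) (fun x _ => hC x)
  rw [hcompl] at h1
  calc _ ≤ |∫ x in sᶜ, f x ∂ν₁| + |∫ x in sᶜ, f x ∂ν₂| := abs_sub _ _
    _ ≤ C * ν₂.real sᶜ + C * ν₂.real sᶜ := add_le_add h1 h2
    _ = _ := by ring

/-- Away from a boundary layer, a translate of the normalized Lebesgue measure of a cube agrees
with the original. -/
theorem map_add_cubeMeasure_restrict {x : Space d} (hx : 2 * ‖x‖ ≤ c) :
    ((cubeMeasure d m).map (· + x)).restrict (cube d (m - c)) =
      (cubeMeasure d m).restrict (cube d (m - c)) := by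
  have hc : 0 ≤ c := (by positivity : 0 ≤ 2 * ‖x‖).trans hx
  ext s hs
  rw [Measure.restrict_apply hs, Measure.restrict_apply hs,
    Measure.map_apply (by fun_prop) (hs.inter measurableSet_cube)]
  simp only [cubeMeasure, Measure.smul_apply]
  congr 1
  rw [Measure.restrict_apply ((hs.inter measurableSet_cube).preimage (by fun_prop)),
    Measure.restrict_apply (hs.inter measurableSet_cube),
    Set.inter_eq_self_of_subset_left (Set.inter_subset_right.trans (cube_sub_subset hc)),
    Set.inter_eq_self_of_subset_left, measure_preimage_add_right]
  rintro y ⟨-, hy⟩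
  have := add_mem_cube (x := -x) (by rwa [norm_neg]) hy
  rwa [add_neg_cancel_right] at this

theorem abs_integral_add_sub_integral_le (hm : 0 < m) {x : Space d} (hx : 2 * ‖x‖ ≤ c)
    {f : Space d → ℝ} (hf : Measurable f) {C : ℝ} (hC : ∀ x, |f x| ≤ C) :
    |∫ y, f (y + x) ∂cubeMeasure d m - ∫ y, f y ∂cubeMeasure d m| ≤
      2 * C * (cubeMeasure d m).real (cube d (m - c))ᶜ := by
  have := isProbabilityMeasure_cubeMeasure (d := d) hm
  have hmap : Measurable fun y : Space d => y + x := by fun_prop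
  have := Measure.isProbabilityMeasure_map (μ := cubeMeasure d m) hmap.aemeasurable
  have h := abs_integral_sub_integral_le_of_restrict_eq measurableSet_cube
    (map_add_cubeMeasure_restrict (m := m) hx) hf hC
  rwa [integral_map hmap.aemeasurable hf.aestronglyMeasurable] at h

end Cubes

/-! ### The mean ergodic theorem for cube averages -/

section Ergodic

variable {d : ℕ} {X : Type*} [MeasurableSpace X] [AddAction (Space d) X] {μ : Measure X}

/-- A set that is invariant up to null sets agrees, up to a null set, with the strictly invariant
set of all points whose orbit is almost entirely contained in it. Hence ergodicity for strictly
invariant sets implies ergodicity in the sense of `ErgodicVAdd`. -/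
theorem ergodicVAdd_of_forall_invariant [MeasurableVAdd₂ (Space d) X] [SFinite μ]
    [VAddInvariantMeasure (Space d) X μ]
    (h : ∀ A : Set X, MeasurableSet A → (∀ x : Space d, (x +ᵥ ·) ⁻¹' A = A) →
      EventuallyConst A (ae μ)) : ErgodicVAdd (Space d) X μ := by
  refine ⟨fun {s} hs hinv => ?_⟩
  have hmeas : MeasurableSet {p : X × Space d | p.2 +ᵥ p.1 ∈ s} :=
    hs.preimage (measurable_snd.vadd measurable_fst)
  set A : Set X := {ω | ∀ᵐ y : Space d, y +ᵥ ω ∈ s} with hA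
  have hAmeas : MeasurableSet A := by
    have h0 := measurable_measure_prodMk_left (ν := (volume : Measure (Space d))) hmeas.compl
    exact h0 (measurableSet_singleton (0 : ℝ≥0∞))
  have hAinv : ∀ x : Space d, (x +ᵥ ·) ⁻¹' A = A := by
    intro x
    ext ω
    simp only [hA, Set.mem_preimage, Set.mem_ofPred_eq, vadd_vadd]
    constructor
    · intro hω
      have := (measurePreserving_add_right (volume : Measure (Space d))
        (-x)).quasiMeasurePreserving.ae hω
      simpa using this
    · intro hω
      exact (measurePreserving_add_right (volume : Measure (Space d))
        x).quasiMeasurePreserving.ae hω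
  have hae : ∀ᵐ ω ∂μ, ∀ᵐ y : Space d, (y +ᵥ ω ∈ s ↔ ω ∈ s) := by
    rw [Measure.ae_ae_comm]
    · refine Eventually.of_forall fun y => ?_
      filter_upwards [hinv y] with ω hω
      exact iff_of_eq hω
    · have : MeasurableSet {p : X × Space d | p.1 ∈ s} := hs.preimage measurable_fst
      have e : {p : X × Space d | p.2 +ᵥ p.1 ∈ s ↔ p.1 ∈ s} =
          ({p | p.2 +ᵥ p.1 ∈ s} ∩ {p | p.1 ∈ s}) ∪ ({p | p.2 +ᵥ p.1 ∈ s}ᶜ ∩ {p | p.1 ∈ s}ᶜ) := by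
        ext p
        simp only [Set.mem_ofPred_eq, Set.mem_union, Set.mem_inter_iff, Set.mem_compl_iff]
        tauto
      rw [e]
      exact (hmeas.inter this).union (hmeas.compl.inter this.compl)
  refine (h A hAmeas hAinv).congr ?_
  filter_upwards [hae] with ω hω
  refine propext ⟨fun h1 => ?_, fun h1 => ?_⟩
  · obtain ⟨y, hy1, hy2⟩ := (Filter.Eventually.and (show ∀ᵐ y : Space d, y +ᵥ ω ∈ s from h1)
      hω).exists
    exact hy2.1 hy1
  · filter_upwards [hω] with y hy using hy.2 h1

variable (d) in
/-- The average of `G` over the part `{y +ᵥ ω | y ∈ [-m/2, m/2]^d}` of the orbit of `ω`. -/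
noncomputable def cubeAverage (m : ℝ) (G : X → ℝ) (ω : X) : ℝ :=
  ∫ y : Space d, G (y +ᵥ ω) ∂cubeMeasure d m

variable [MeasurableVAdd₂ (Space d) X]

theorem measurable_cubeAverage {m : ℝ} {G : X → ℝ} (hG : Measurable G) :
    Measurable (cubeAverage d m G) := by
  have : StronglyMeasurable fun p : X × Space d => G (p.2 +ᵥ p.1) :=
    (hG.comp (measurable_snd.vadd measurable_fst)).stronglyMeasurable
  exact this.integral_prod_right'.measurable

theorem integrable_comp_vadd {m : ℝ} {G : X → ℝ} (hG : Measurable G) {C : ℝ}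
    (hC : ∀ ω, |G ω| ≤ C) (ω : X) :
    Integrable (fun y : Space d => G (y +ᵥ ω)) (cubeMeasure d m) :=
  Integrable.of_bound (hG.comp (measurable_id.vadd_const ω)).aestronglyMeasurable C
    (Eventually.of_forall fun _ => hC _)

/-- Cube averaging is a contraction of `L¹`. -/
theorem lintegral_enorm_cubeAverage_le [SFinite μ] [VAddInvariantMeasure (Space d) X μ] {m : ℝ}
    (hm : 0 < m) {G : X → ℝ} (hG : Measurable G) :
    ∫⁻ ω, ‖cubeAverage d m G ω‖ₑ ∂μ ≤ ∫⁻ ω, ‖G ω‖ₑ ∂μ := by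
  have := isProbabilityMeasure_cubeMeasure (d := d) hm
  calc ∫⁻ ω, ‖cubeAverage d m G ω‖ₑ ∂μ
      ≤ ∫⁻ ω, ∫⁻ y : Space d, ‖G (y +ᵥ ω)‖ₑ ∂cubeMeasure d m ∂μ :=
        lintegral_mono fun ω => enorm_integral_le_lintegral_enorm _
    _ = ∫⁻ y : Space d, ∫⁻ ω, ‖G (y +ᵥ ω)‖ₑ ∂μ ∂cubeMeasure d m :=
        lintegral_lintegral_swap
          (hG.comp (measurable_snd.vadd measurable_fst)).enorm.aemeasurable
    _ = ∫⁻ _ : Space d, ∫⁻ ω, ‖G ω‖ₑ ∂μ ∂cubeMeasure d m := by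
        congr 1 with y
        exact (measurePreserving_vadd y μ).lintegral_comp hG.enorm
    _ = ∫⁻ ω, ‖G ω‖ₑ ∂μ := by simp

/-- Cube averages of a bounded coboundary tend to zero uniformly. -/
theorem tendsto_lintegral_cubeAverage_coboundary [IsProbabilityMeasure μ] {G : X → ℝ}
    (hG : Measurable G) {C : ℝ} (hC : ∀ ω, |G ω| ≤ C) (x : Space d) :
    Tendsto (fun m => ∫⁻ ω, ‖cubeAverage d m (fun ω => G (x +ᵥ ω) - G ω) ω‖ₑ ∂μ) atTop (𝓝 0) := by
  have h1 := (tendsto_cubeMeasure_compl (d := d) (c := 2 * ‖x‖) (by positivity)).const_mul (2 * C)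
  rw [mul_zero] at h1
  have h2 := ENNReal.tendsto_ofReal h1
  rw [ENNReal.ofReal_zero] at h2
  refine tendsto_of_tendsto_of_tendsto_of_le_of_le' tendsto_const_nhds h2
    (Eventually.of_forall fun _ => zero_le) ?_
  filter_upwards [eventually_gt_atTop 0] with m hm
  calc ∫⁻ ω, ‖cubeAverage d m (fun ω => G (x +ᵥ ω) - G ω) ω‖ₑ ∂μ
      ≤ ∫⁻ _, ENNReal.ofReal (2 * C * (cubeMeasure d m).real (cube d (m - 2 * ‖x‖))ᶜ) ∂μ := by
        refine lintegral_mono fun ω => ?_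
        rw [Real.enorm_eq_ofReal_abs]
        refine ENNReal.ofReal_le_ofReal ?_
        have h := abs_integral_add_sub_integral_le hm (x := x) le_rfl
          (f := fun y => G (y +ᵥ ω)) (hG.comp (measurable_id.vadd_const ω)) (fun _ => hC _)
        have e : cubeAverage d m (fun ω => G (x +ᵥ ω) - G ω) ω =
            ∫ y : Space d, G ((y + x) +ᵥ ω) ∂cubeMeasure d m -
              ∫ y : Space d, G (y +ᵥ ω) ∂cubeMeasure d m := by
          rw [cubeAverage, integral_sub]
          · simp only [vadd_vadd, add_comm x]
          · simp only [vadd_vadd]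
            exact Integrable.of_bound (hG.comp ((measurable_const.add measurable_id).vadd_const
              ω)).aestronglyMeasurable C (Eventually.of_forall fun _ => hC _)
          · exact integrable_comp_vadd hG hC ω
        rw [e]
        exact h
    _ = _ := by simp

variable (d μ) in
/-- The subspace of `L²` of the classes of bounded functions `G` whose cube averages converge to
`∫ G` in `L¹`. -/
def convergenceSubspace [IsProbabilityMeasure μ] : Submodule ℝ (Lp ℝ 2 μ) where
  carrier := {g | ∃ G : X → ℝ, Measurable G ∧ (∃ C, ∀ ω, |G ω| ≤ C) ∧ g =ᵐ[μ] G ∧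
    Tendsto (fun m => ∫⁻ ω, ‖cubeAverage d m G ω - ∫ η, G η ∂μ‖ₑ ∂μ) atTop (𝓝 0)}
  zero_mem' := ⟨0, measurable_zero, ⟨0, by simp⟩, Lp.coeFn_zero _ _ _, by simp [cubeAverage]⟩
  add_mem' := by
    rintro g₁ g₂ ⟨G₁, hm₁, ⟨C₁, hC₁⟩, he₁, ht₁⟩ ⟨G₂, hm₂, ⟨C₂, hC₂⟩, he₂, ht₂⟩
    refine ⟨G₁ + G₂, hm₁.add hm₂, ⟨C₁ + C₂, fun ω => (abs_add_le _ _).trans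
      (add_le_add (hC₁ ω) (hC₂ ω))⟩, (Lp.coeFn_add _ _).trans (he₁.add he₂), ?_⟩
    have h := ht₁.add ht₂
    rw [add_zero] at h
    refine tendsto_of_tendsto_of_tendsto_of_le_of_le tendsto_const_nhds h (fun _ => zero_le)
      fun m => ?_
    change _ ≤ ∫⁻ ω, ‖cubeAverage d m G₁ ω - ∫ η, G₁ η ∂μ‖ₑ ∂μ +
      ∫⁻ ω, ‖cubeAverage d m G₂ ω - ∫ η, G₂ η ∂μ‖ₑ ∂μ
    rw [← lintegral_add_left ((measurable_cubeAverage hm₁).sub_const _).enorm]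
    refine lintegral_mono fun ω => ?_
    have e1 : cubeAverage d m (G₁ + G₂) ω = cubeAverage d m G₁ ω + cubeAverage d m G₂ ω :=
      integral_add (integrable_comp_vadd hm₁ hC₁ ω) (integrable_comp_vadd hm₂ hC₂ ω)
    have e2 : ∫ η, (G₁ + G₂) η ∂μ = ∫ η, G₁ η ∂μ + ∫ η, G₂ η ∂μ :=
      integral_add (Integrable.of_bound hm₁.aestronglyMeasurable C₁ (Eventually.of_forall hC₁))
        (Integrable.of_bound hm₂.aestronglyMeasurable C₂ (Eventually.of_forall hC₂))
    rw [e1, e2, add_sub_add_comm]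
    exact enorm_add_le _ _
  smul_mem' := by
    rintro a g ⟨G, hm, ⟨C, hC⟩, he, ht⟩
    refine ⟨a • G, hm.const_smul a, ⟨|a| * C, fun ω => ?_⟩, (Lp.coeFn_smul _ _).trans
      (he.const_smul a), ?_⟩
    · simp only [Pi.smul_apply, smul_eq_mul, abs_mul]
      exact mul_le_mul_of_nonneg_left (hC ω) (abs_nonneg a)
    · have h := ENNReal.Tendsto.const_mul (a := ‖a‖ₑ) ht (Or.inr enorm_ne_top)
      rw [mul_zero] at h
      refine h.congr fun m => ?_
      rw [← lintegral_const_mul _ ((measurable_cubeAverage hm).sub_const _).enorm]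
      refine lintegral_congr fun ω => ?_
      simp only [cubeAverage, Pi.smul_apply, integral_smul]
      rw [← smul_sub, smul_eq_mul, enorm_mul]

theorem toLp_mem_convergenceSubspace [IsProbabilityMeasure μ] {G : X → ℝ} (hG : Measurable G)
    {C : ℝ} (hC : ∀ ω, |G ω| ≤ C) (hmem : MemLp G 2 μ)
    (h : Tendsto (fun m => ∫⁻ ω, ‖cubeAverage d m G ω - ∫ η, G η ∂μ‖ₑ ∂μ) atTop (𝓝 0)) :
    hmem.toLp G ∈ convergenceSubspace d μ :=
  ⟨G, hG, ⟨C, hC⟩, hmem.coeFn_toLp, h⟩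

theorem inner_toLp_eq_integral {p : Lp ℝ 2 μ} {G : X → ℝ} (hG : MemLp G 2 μ) :
    inner ℝ (hG.toLp G) p = ∫ ω, p ω * G ω ∂μ := by
  rw [L2.inner_def]
  refine integral_congr_ae ?_
  filter_upwards [hG.coeFn_toLp] with ω hω
  simp [hω]

/-- An element of `L²` that is orthogonal to all bounded coboundaries is invariant, by duality, so
that its sign is a.e. constant by ergodicity; if it is orthogonal to the constants as well, then it
vanishes. -/
theorem convergenceSubspace_orthogonal_eq_bot [IsProbabilityMeasure μ]
    [ErgodicVAdd (Space d) X μ] : (convergenceSubspace d μ)ᗮ = ⊥ := by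
  rw [Submodule.eq_bot_iff]
  intro p hp
  rw [Submodule.mem_orthogonal] at hp
  have hpint : Integrable p μ := (Lp.memLp p).integrable (by norm_num)
  have hpmeas : Measurable p := (Lp.stronglyMeasurable p).measurable
  have hzero : ∫ ω, p ω ∂μ = 0 := by
    have hmem : MemLp (fun _ : X => (1 : ℝ)) 2 μ := memLp_const 1
    have h := hp _ (toLp_mem_convergenceSubspace (d := d) measurable_const (C := 1) (by simp)
      hmem ?_)
    · rw [inner_toLp_eq_integral] at h
      simpa using h
    · refine tendsto_const_nhds.congr' ?_
      filter_upwards [eventually_gt_atTop 0] with m hm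
      have := isProbabilityMeasure_cubeMeasure (d := d) hm
      simp [cubeAverage]
  -- The indicator `G` of `s` gives the coboundary `G ∘ τ_{-x} - G`; orthogonality to it says that
  -- `p ∘ τ_x` and `p` have the same integral over `s`.
  have hinv : ∀ x : Space d, (fun ω => p (x +ᵥ ω)) =ᵐ[μ] p := by
    intro x
    have hcomp : Integrable (fun ω => p (x +ᵥ ω)) μ :=
      (measurePreserving_vadd x μ).integrable_comp_of_integrable hpint
    refine hcomp.ae_eq_of_forall_setIntegral_eq _ _ hpint fun s hs _ => ?_
    set G : X → ℝ := s.indicator 1 with hGdef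
    have hG : Measurable G := measurable_one.indicator hs
    have hC : ∀ ω, |G ω| ≤ 1 := fun ω => by
      by_cases hω : ω ∈ s <;> simp [hGdef, hω]
    have hGx : Measurable fun ω => G (-x +ᵥ ω) := hG.comp (measurable_const_vadd (-x))
    have hcob : Measurable fun ω => G (-x +ᵥ ω) - G ω := hGx.sub hG
    have hcobC : ∀ ω, |G (-x +ᵥ ω) - G ω| ≤ 2 := fun ω => by
      refine (abs_sub _ _).trans ?_
      linarith [hC ω, hC (-x +ᵥ ω)]
    have hmem : MemLp (fun ω => G (-x +ᵥ ω) - G ω) 2 μ :=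
      MemLp.of_bound hcob.aestronglyMeasurable 2 (Eventually.of_forall hcobC)
    have hGint : Integrable G μ :=
      Integrable.of_bound hG.aestronglyMeasurable 1 (Eventually.of_forall hC)
    have hGxint : Integrable (fun ω => G (-x +ᵥ ω)) μ :=
      Integrable.of_bound hGx.aestronglyMeasurable 1 (Eventually.of_forall fun _ => hC _)
    have hmean : ∫ ω, (G (-x +ᵥ ω) - G ω) ∂μ = 0 := by
      rw [integral_sub hGxint hGint, sub_eq_zero]
      exact (measurePreserving_vadd (-x) μ).integral_comp
        (measurableEmbedding_const_vadd (-x)) G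
    have h := hp _ (toLp_mem_convergenceSubspace hcob hcobC hmem (by
      simpa only [hmean, sub_zero] using tendsto_lintegral_cubeAverage_coboundary hG hC (-x)))
    rw [inner_toLp_eq_integral] at h
    simp only [mul_sub] at h
    rw [integral_sub (hpint.mul_bdd hGx.aestronglyMeasurable (Eventually.of_forall fun _ => hC _))
      (hpint.mul_bdd hG.aestronglyMeasurable (Eventually.of_forall hC)), sub_eq_zero] at h
    have e1 : ∀ f : X → ℝ, ∫ ω in s, f ω ∂μ = ∫ ω, f ω * G ω ∂μ := fun f => by
      rw [← integral_indicator hs]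
      refine integral_congr_ae (Eventually.of_forall fun ω => ?_)
      by_cases hω : ω ∈ s <;> simp [hGdef, hω]
    rw [e1, e1, ← h, ← (measurePreserving_vadd x μ).integral_comp
      (measurableEmbedding_const_vadd x) (fun ω => p ω * G (-x +ᵥ ω))]
    simp only [neg_vadd_vadd]
  have hpos : MeasurableSet {ω | 0 < p ω} := measurableSet_lt measurable_const hpmeas
  have hconst := aeconst_of_forall_preimage_vadd_ae_eq (Space d) hpos.nullMeasurableSet
    (μ := μ) fun x => by
      filter_upwards [hinv x] with ω hω
      exact congrArg (fun t : ℝ => 0 < t) hω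
  have key : p =ᵐ[μ] 0 := by
    rw [eventuallyConst_set] at hconst
    rcases hconst with h | h
    · exact (integral_eq_zero_iff_of_nonneg_ae (h.mono fun _ h => le_of_lt h) hpint).1 hzero
    · have h' : 0 ≤ᵐ[μ] fun ω => -p ω := by
        filter_upwards [h] with ω hω
        simpa using hω
      have := (integral_eq_zero_iff_of_nonneg_ae h' hpint.neg).1 (by
        rw [integral_neg, hzero, neg_zero])
      filter_upwards [this] with ω hω
      simpa using hω
  exact (Lp.eq_zero_iff_ae_eq_zero).2 key

/-- **Mean ergodic theorem** for cube averages of bounded functions. -/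
theorem tendsto_lintegral_enorm_cubeAverage_sub [IsProbabilityMeasure μ]
    [ErgodicVAdd (Space d) X μ] {F : X → ℝ} (hF : Measurable F) {C : ℝ} (hC : ∀ ω, |F ω| ≤ C) :
    Tendsto (fun m => ∫⁻ ω, ‖cubeAverage d m F ω - ∫ η, F η ∂μ‖ₑ ∂μ) atTop (𝓝 0) := by
  have hmem : MemLp F 2 μ := MemLp.of_bound hF.aestronglyMeasurable C (Eventually.of_forall hC)
  have hFint : Integrable F μ := hmem.integrable (by norm_num)
  have hdense : hmem.toLp F ∈ closure (convergenceSubspace d μ : Set (Lp ℝ 2 μ)) := by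
    rw [← Submodule.topologicalClosure_coe,
      Submodule.topologicalClosure_eq_top_iff.2 convergenceSubspace_orthogonal_eq_bot]
    trivial
  rw [ENNReal.tendsto_nhds_zero]
  intro ε hε
  have hε3 : 0 < ε / 3 := ENNReal.div_pos hε.ne' (by norm_num)
  obtain ⟨g, ⟨G, hGm, ⟨C', hC'⟩, hGe, hGt⟩, hg⟩ := EMetric.mem_closure_iff.1 hdense (ε / 3) hε3
  have hGint : Integrable G μ :=
    Integrable.of_bound hGm.aestronglyMeasurable C' (Eventually.of_forall hC')
  have hclose : ∫⁻ ω, ‖F ω - G ω‖ₑ ∂μ ≤ ε / 3 := by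
    have h1 : eLpNorm (fun ω => F ω - G ω) 1 μ ≤ eLpNorm (fun ω => F ω - G ω) 2 μ :=
      eLpNorm_le_eLpNorm_of_exponent_le (by norm_num) (hF.sub hGm).aestronglyMeasurable
    rw [eLpNorm_one_eq_lintegral_enorm] at h1
    refine h1.trans (le_trans (le_of_eq ?_) hg.le)
    rw [Lp.edist_def]
    refine eLpNorm_congr_ae ?_
    filter_upwards [hmem.coeFn_toLp, hGe] with ω h1 h2
    simp [h1, h2]
  have hmean : ‖∫ η, G η ∂μ - ∫ η, F η ∂μ‖ₑ ≤ ε / 3 := by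
    rw [← integral_sub hGint hFint]
    refine (enorm_integral_le_lintegral_enorm _).trans (le_trans (le_of_eq ?_) hclose)
    exact lintegral_congr fun ω => enorm_sub_rev _ _
  filter_upwards [ENNReal.tendsto_nhds_zero.1 hGt (ε / 3) hε3, eventually_gt_atTop 0] with m hm hm0
  have hFG : Measurable fun ω => F ω - G ω := hF.sub hGm
  calc ∫⁻ ω, ‖cubeAverage d m F ω - ∫ η, F η ∂μ‖ₑ ∂μ
      ≤ ∫⁻ ω, (‖cubeAverage d m (fun ω => F ω - G ω) ω‖ₑ +
          (‖cubeAverage d m G ω - ∫ η, G η ∂μ‖ₑ + ‖∫ η, G η ∂μ - ∫ η, F η ∂μ‖ₑ)) ∂μ := by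
        refine lintegral_mono fun ω => ?_
        have e : cubeAverage d m F ω - ∫ η, F η ∂μ =
            cubeAverage d m (fun ω => F ω - G ω) ω + ((cubeAverage d m G ω - ∫ η, G η ∂μ) +
              (∫ η, G η ∂μ - ∫ η, F η ∂μ)) := by
          have : cubeAverage d m (fun ω => F ω - G ω) ω =
              cubeAverage d m F ω - cubeAverage d m G ω :=
            integral_sub (integrable_comp_vadd hF hC ω) (integrable_comp_vadd hGm hC' ω)
          rw [this]
          ring
        simp only [e]
        exact (enorm_add_le _ _).trans (add_le_add le_rfl (enorm_add_le _ _))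
    _ = ∫⁻ ω, ‖cubeAverage d m (fun ω => F ω - G ω) ω‖ₑ ∂μ +
          (∫⁻ ω, ‖cubeAverage d m G ω - ∫ η, G η ∂μ‖ₑ ∂μ +
            ‖∫ η, G η ∂μ - ∫ η, F η ∂μ‖ₑ) := by
        rw [lintegral_add_left (measurable_cubeAverage hFG).enorm,
          lintegral_add_right _ measurable_const, lintegral_const, measure_univ, mul_one]
    _ ≤ ε / 3 + (ε / 3 + ε / 3) :=
        add_le_add ((lintegral_enorm_cubeAverage_le hm0 hFG).trans hclose) (add_le_add hm hmean)
    _ = ε := by rw [← add_assoc, ENNReal.add_thirds]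

end Ergodic

/-! ### The topology of the space of environments -/

section EnvTopology

variable {d : ℕ} {lam Lam r : ℝ}

theorem differentiable_entry (ω : Env d lam Lam r) (i j : Fin d) :
    Differentiable ℝ fun z => ω.toFun z i j :=
  (ω.contDiff_entry i j).differentiable one_ne_zero

theorem gradNorm_sub (ω η : Env d lam Lam r) (x : Space d) :
    gradNorm (ω.toFun - η.toFun) x = ∑ i, ∑ j,
      ‖fderiv ℝ (fun z => ω.toFun z i j) x - fderiv ℝ (fun z => η.toFun z i j) x‖ := by
  refine Finset.sum_congr rfl fun i _ => Finset.sum_congr rfl fun j _ => ?_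
  rw [← fderiv_sub (differentiable_entry ω i j x) (differentiable_entry η i j x)]
  rfl

/-- The value and the gradient of all entries of an environment, as a continuous function. -/
noncomputable def oneJet (ω : Env d lam Lam r) :
    C(Space d, Fin d → Fin d → ℝ × (Space d →L[ℝ] ℝ)) where
  toFun x i j := (ω.toFun x i j, fderiv ℝ (fun z => ω.toFun z i j) x)
  continuous_toFun := continuous_pi fun i => continuous_pi fun j =>
    (ω.contDiff_entry i j).continuous.prodMk ((ω.contDiff_entry i j).continuous_fderiv one_ne_zero)

theorem oneJet_apply (ω : Env d lam Lam r) (x : Space d) (i j : Fin d) :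
    oneJet ω x i j = (ω.toFun x i j, fderiv ℝ (fun z => ω.toFun z i j) x) := rfl

theorem dist_oneJet_le_c1Norm (ω η : Env d lam Lam r) {K : ℕ} {x : Space d} (hx : ‖x‖ ≤ K) :
    dist (oneJet ω x) (oneJet η x) ≤ c1Norm K (ω.toFun - η.toFun) := by
  have hC : IsC1 (ω.toFun - η.toFun) := IsC1.sub ω.contDiff_entry η.contDiff_entry
  have h1 : matNorm ((ω.toFun - η.toFun) x) ≤ c1Norm K (ω.toFun - η.toFun) :=
    matNorm_le_c1Norm hC hx
  have h2 : gradNorm (ω.toFun - η.toFun) x ≤ c1Norm K (ω.toFun - η.toFun) := by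
    have h := le_ciSup (bddAbove_ball (continuous_gradNorm hC) K) ⟨x, by simpa using hx⟩
    have h' : (0 : ℝ) ≤ ⨆ x : Metric.closedBall (0 : Space d) K,
        matNorm ((ω.toFun - η.toFun) x) := Real.iSup_nonneg fun _ => matNorm_nonneg _
    unfold c1Norm
    linarith
  have hentry : ∀ (a : Fin d → Fin d → ℝ), (∀ i j, 0 ≤ a i j) → ∀ i j,
      a i j ≤ ∑ i, ∑ j, a i j := fun a ha i j =>
    (Finset.single_le_sum (f := a i) (fun _ _ => ha _ _) (Finset.mem_univ j)).trans
      (Finset.single_le_sum (f := fun i => ∑ j, a i j)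
        (fun _ _ => Finset.sum_nonneg fun _ _ => ha _ _) (Finset.mem_univ i))
  refine (dist_pi_le_iff (c1Norm_nonneg _ _)).2 fun i => (dist_pi_le_iff (c1Norm_nonneg _ _)).2
    fun j => ?_
  rw [oneJet_apply, oneJet_apply, Prod.dist_eq, dist_eq_norm, dist_eq_norm]
  refine max_le (le_trans ?_ h1) (le_trans ?_ h2)
  · exact hentry (fun i j => |(ω.toFun - η.toFun) x i j|) (fun _ _ => abs_nonneg _) i j
  · rw [gradNorm_sub]
    exact hentry (fun i j => ‖fderiv ℝ (fun z => ω.toFun z i j) x -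
      fderiv ℝ (fun z => η.toFun z i j) x‖) (fun _ _ => norm_nonneg _) i j

theorem c1Norm_le_of_dist_oneJet_le (ω η : Env d lam Lam r) {K : ℕ} {ε : ℝ}
    (h : ∀ x : Space d, ‖x‖ ≤ K → dist (oneJet ω x) (oneJet η x) ≤ ε) :
    c1Norm K (ω.toFun - η.toFun) ≤ 2 * (d * d * ε) := by
  have hε : 0 ≤ ε := dist_nonneg.trans (h 0 (by simp))
  have hij : ∀ x : Space d, ‖x‖ ≤ K → ∀ i j, dist (oneJet ω x i j) (oneJet η x i j) ≤ ε :=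
    fun x hx i j => (dist_le_pi_dist _ _ j).trans ((dist_le_pi_dist _ _ i).trans (h x hx))
  have hsum : ∀ a : Fin d → Fin d → ℝ, (∀ i j, a i j ≤ ε) → ∑ i, ∑ j, a i j ≤ d * d * ε :=
    fun a ha => calc
      ∑ i, ∑ j, a i j ≤ ∑ _i : Fin d, ∑ _j : Fin d, ε :=
        Finset.sum_le_sum fun i _ => Finset.sum_le_sum fun j _ => ha i j
      _ = d * d * ε := by simp [mul_assoc]
  have h1 : (⨆ x : Metric.closedBall (0 : Space d) K, matNorm ((ω.toFun - η.toFun) x)) ≤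
      d * d * ε := by
    refine ciSup_le fun x => hsum _ fun i j =>
      le_trans ?_ (hij x (mem_closedBall_zero_iff.1 x.2) i j)
    rw [Prod.dist_eq]
    exact le_max_left _ _
  have h2 : (⨆ x : Metric.closedBall (0 : Space d) K, gradNorm (ω.toFun - η.toFun) x) ≤
      d * d * ε := by
    refine ciSup_le fun x => ?_
    rw [gradNorm_sub]
    refine hsum _ fun i j => le_trans ?_ (hij x (mem_closedBall_zero_iff.1 x.2) i j)
    rw [Prod.dist_eq, ← dist_eq_norm]
    exact le_max_right _ _
  unfold c1Norm
  linarith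

theorem tendsto_iff_c1Norm {ι : Type*} {l : Filter ι} {u : ι → Env d lam Lam r}
    {ω : Env d lam Lam r} : Tendsto u l (𝓝 ω) ↔
      ∀ k : ℕ, Tendsto (fun i => c1Norm (k + 1) ((u i).toFun - ω.toFun)) l (𝓝 0) := by
  rw [tendsto_iff_dist_tendsto_zero]
  have hnn : ∀ (k : ℕ) (f : Space d → Matrix (Fin d) (Fin d) ℝ),
      0 ≤ c1Norm k f / (1 + c1Norm k f) := fun k f => by
    have := c1Norm_nonneg k f
    positivity
  constructor
  · intro h k
    have h1 : Tendsto (fun i => c1Norm (k + 1) ((u i).toFun - ω.toFun) /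
        (1 + c1Norm (k + 1) ((u i).toFun - ω.toFun))) l (𝓝 0) := by
      have h2 := h.const_mul (2 ^ (k + 1) : ℝ)
      rw [mul_zero] at h2
      refine squeeze_zero (fun i => hnn _ _) (fun i => ?_) h2
      have h3 := (summable_term ((u i).toFun - ω.toFun)).le_tsum k
        fun j _ => mul_nonneg (by positivity) (hnn _ _)
      change _ ≤ dist (u i) ω at h3
      rwa [one_div, inv_mul_le_iff₀ (by positivity)] at h3
    -- `s ↦ s / (1 - s)` inverts `t ↦ t / (1 + t)`.
    have h2 : Tendsto (fun s : ℝ => s / (1 - s)) (𝓝 0) (𝓝 0) := by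
      have : ContinuousAt (fun s : ℝ => s / (1 - s)) 0 := by fun_prop (disch := norm_num)
      simpa [ContinuousAt] using this
    refine (h2.comp h1).congr fun i => ?_
    have := c1Norm_nonneg (k + 1) ((u i).toFun - ω.toFun)
    have h3 : 1 + c1Norm (k + 1) ((u i).toFun - ω.toFun) ≠ 0 := by positivity
    simp only [Function.comp_apply]
    rw [one_sub_div h3, add_sub_cancel_right, div_div_div_cancel_right₀ h3, div_one]
  · intro h
    have h0 := tendsto_tsum_of_dominated_convergence (𝓕 := l)
      (f := fun i (k : ℕ) => (1 / 2 ^ (k + 1) : ℝ) *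
        (c1Norm (k + 1) ((u i).toFun - ω.toFun) / (1 + c1Norm (k + 1) ((u i).toFun - ω.toFun))))
      (g := fun _ => 0) (bound := fun k : ℕ => (1 / 2 ^ (k + 1) : ℝ)) summable_half ?_ ?_
    · rw [tsum_zero] at h0
      exact h0
    · intro k
      have h2 : Tendsto (fun t : ℝ => (1 / 2 ^ (k + 1) : ℝ) * (t / (1 + t))) (𝓝 0) (𝓝 0) := by
        have : ContinuousAt (fun t : ℝ => (1 / 2 ^ (k + 1) : ℝ) * (t / (1 + t))) 0 := by
          fun_prop (disch := norm_num)
        simpa [ContinuousAt] using this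
      exact h2.comp (h k)
    · refine Eventually.of_forall fun i k => ?_
      rw [Real.norm_of_nonneg (mul_nonneg (by positivity) (hnn _ _))]
      exact mul_le_of_le_one_right (by positivity) (frac_le_one (c1Norm_nonneg _ _))

/-- Convergence of environments is locally uniform convergence of the `1`-jets. -/
theorem tendsto_iff_oneJet {ι : Type*} {l : Filter ι} {u : ι → Env d lam Lam r}
    {ω : Env d lam Lam r} :
    Tendsto u l (𝓝 ω) ↔ Tendsto (fun i => oneJet (u i)) l (𝓝 (oneJet ω)) := by
  rw [tendsto_iff_c1Norm, ContinuousMap.tendsto_iff_forall_isCompact_tendstoUniformlyOn]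
  constructor
  · intro h S hS
    obtain ⟨R, hR⟩ := hS.isBounded.subset_closedBall 0
    obtain ⟨k, hk⟩ := exists_nat_ge R
    rw [Metric.tendstoUniformlyOn_iff]
    intro ε hε
    filter_upwards [(h k).eventually_lt_const hε] with i hi x hx
    rw [dist_comm]
    refine (dist_oneJet_le_c1Norm _ _ ?_).trans_lt hi
    have := hR hx
    rw [mem_closedBall_zero_iff] at this
    push_cast
    linarith
  · intro h k
    have h1 := h _ (isCompact_closedBall (0 : Space d) ((k + 1 : ℕ) : ℝ))
    rw [Metric.tendstoUniformlyOn_iff] at h1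
    rw [Metric.tendsto_nhds]
    intro ε hε
    have hδ : 0 < ε / (2 * (d * d) + 1) := by positivity
    filter_upwards [h1 _ hδ] with i hi
    rw [Real.dist_eq, sub_zero, abs_of_nonneg (c1Norm_nonneg _ _)]
    refine (c1Norm_le_of_dist_oneJet_le _ _ (ε := ε / (2 * (d * d) + 1)) fun x hx => ?_).trans_lt ?_
    · rw [dist_comm]
      exact (hi x (by simpa using hx)).le
    · rw [← mul_assoc, ← mul_div_assoc, div_lt_iff₀ (by positivity)]
      nlinarith

/-- The metric `frechetDist` induces the topology of locally uniform convergence of the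
environment and of its gradient. -/
theorem isInducing_oneJet : IsInducing (oneJet (d := d) (lam := lam) (Lam := Lam) (r := r)) := by
  refine isInducing_iff_nhds.2 fun ω => le_antisymm ?_ ?_
  · exact (tendsto_iff_oneJet.1 (tendsto_id : Tendsto id (𝓝 ω) (𝓝 ω))).le_comap
  · have h : Tendsto id (comap oneJet (𝓝 (oneJet ω))) (𝓝 ω) := tendsto_iff_oneJet.2 tendsto_comap
    exact h

instance : SecondCountableTopology (Env d lam Lam r) := isInducing_oneJet.secondCountableTopology

/-- The action of `ℝ^d` on environments by translations. -/
instance : AddAction (Space d) (Env d lam Lam r) where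
  vadd := Env.shift
  zero_vadd ω := Env.ext (funext fun y => congrArg ω.toFun (zero_add y))
  add_vadd x y ω := Env.ext (funext fun z => congrArg ω.toFun (by abel))

theorem oneJet_shift (x : Space d) (ω : Env d lam Lam r) (z : Space d) :
    oneJet (Env.shift x ω) z = oneJet ω (x + z) := by
  funext i j
  refine Prod.ext rfl ?_
  exact fderiv_comp_add_left (f := fun z => ω.toFun z i j) x

instance : ContinuousVAdd (Space d) (Env d lam Lam r) := by
  refine ⟨isInducing_oneJet.continuous_iff.2 (ContinuousMap.continuous_of_continuous_uncurry _ ?_)⟩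
  have h : Continuous fun p : (Space d × Env d lam Lam r) × Space d =>
      oneJet p.1.2 (p.1.1 + p.2) :=
    (isInducing_oneJet.continuous.comp (continuous_snd.comp continuous_fst)).eval (by fun_prop)
  exact h.congr fun p => (oneJet_shift _ _ _).symm

instance : MeasurableVAdd₂ (Space d) (Env d lam Lam r) := ⟨continuous_vadd.measurable⟩

theorem vaddInvariantMeasure {μ : Measure (Env d lam Lam r)} (h : IsShiftInvariant μ) :
    VAddInvariantMeasure (Space d) (Env d lam Lam r) μ := by
  refine ⟨fun x s hs => ?_⟩
  rw [← Measure.map_apply (measurable_const_vadd x) hs]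
  exact congrArg (fun ν => ν s) (h x)

theorem ergodicVAdd {μ : Measure (Env d lam Lam r)} [IsProbabilityMeasure μ]
    (hinv : IsShiftInvariant μ) (herg : IsShiftErgodic μ) :
    ErgodicVAdd (Space d) (Env d lam Lam r) μ := by
  have := vaddInvariantMeasure hinv
  refine ergodicVAdd_of_forall_invariant fun A hA hinvA => ?_
  rw [eventuallyConst_set']
  have h : ∀ x : Space d, Env.shift x '' A = A := fun x => by
    have e : (fun ω : Env d lam Lam r => -x +ᵥ ω) ⁻¹' A = (x +ᵥ ·) '' A :=
      Set.ext fun ω => ⟨fun h => ⟨_, h, vadd_neg_vadd x ω⟩, by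
        rintro ⟨η, hη, rfl⟩
        simpa using hη⟩
    exact e.symm.trans (hinvA (-x))
  rcases herg A hA h with h0 | h1
  · exact Or.inl (ae_eq_empty.2 h0)
  · exact Or.inr (by rwa [ae_eq_univ, prob_compl_eq_zero_iff hA])

end EnvTopology

/-! ### Periodization -/

section Periodization

/-- The identity on an interval slightly shorter than the period extends to a periodic `C¹`
function, namely to the primitive of `1 - c b`, where `b` is the periodic function with
`b(t) = (dist(t, mℤ) - (m/2 - L))⁺`, which vanishes for `|t| ≤ m/2 - L`, and where `c` is such that
`1 - c b` has mean zero over a period. -/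
theorem exists_periodic_contDiff_eq_id {m L : ℝ} (hm : 0 < m) (hL : 0 < L) :
    ∃ h : ℝ → ℝ, ContDiff ℝ 1 h ∧ Function.Periodic h m ∧ ∀ t, |t| ≤ m / 2 - L → h t = t := by
  set b : ℝ → ℝ := fun t => max 0 (‖(t : AddCircle m)‖ - (m / 2 - L)) with hb
  have hbc : Continuous b := by
    have : Continuous fun t : ℝ => ‖(t : AddCircle m)‖ := (AddCircle.continuous_mk' m).norm
    fun_prop
  have hbp : Function.Periodic b m := fun t => by simp [hb]
  set J : ℝ := ∫ t in (0 : ℝ)..m, b t with hJ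
  have hJpos : 0 < J := by
    refine intervalIntegral.integral_pos hm hbc.continuousOn (fun _ _ => le_max_left _ _)
      ⟨m / 2, ⟨by linarith, by linarith⟩, ?_⟩
    refine lt_max_of_lt_right ?_
    rw [AddCircle.norm_half_period_eq, abs_of_pos hm]
    linarith
  have hφc : Continuous fun t => 1 - m / J * b t := by fun_prop
  refine ⟨fun s => ∫ t in (0 : ℝ)..s, (1 - m / J * b t), ?_, ?_, ?_⟩
  · rw [contDiff_one_iff_deriv]
    refine ⟨fun s => (hφc.integral_hasStrictDerivAt 0 s).hasDerivAt.differentiableAt, ?_⟩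
    have : deriv (fun s => ∫ t in (0 : ℝ)..s, (1 - m / J * b t)) = fun t => 1 - m / J * b t :=
      funext fun s => hφc.deriv_integral _ 0 s
    rwa [this]
  · intro s
    have hφp : Function.Periodic (fun t => 1 - m / J * b t) m := fun t => by
      simp only [hbp t]
    have h1 : ∫ t in s..(s + m), (1 - m / J * b t) = 0 := by
      rw [hφp.intervalIntegral_add_eq s 0, zero_add, intervalIntegral.integral_sub
        intervalIntegrable_const ((hbc.intervalIntegrable _ _).const_mul _),
        intervalIntegral.integral_const_mul, intervalIntegral.integral_const, ← hJ,
        div_mul_cancel₀ _ hJpos.ne']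
      simp
    have h2 := intervalIntegral.integral_add_adjacent_intervals (hφc.intervalIntegrable 0 s)
      (hφc.intervalIntegrable s (s + m)) (μ := volume)
    rw [h1, add_zero] at h2
    exact h2.symm
  · intro t ht
    have h1 : Set.EqOn (fun t => 1 - m / J * b t) (fun _ => 1) (Set.uIcc 0 t) := by
      intro s hs
      have h2 : ‖(s : AddCircle m)‖ ≤ |s| := QuotientAddGroup.norm_mk_le_norm
      have h3 : |s| ≤ |t| := by
        simpa using Set.abs_sub_left_of_mem_uIcc hs
      have h4 : b s = 0 := max_eq_left (by linarith)
      simp [h4]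
    simp only
    rw [intervalIntegral.integral_congr h1]
    simp

variable {d : ℕ} {lam Lam r : ℝ}

/-- The composition of an environment with a `C¹` self-map of `ℝ^d`. All the pointwise constraints
on environments are inherited. -/
def Env.comp (ω : Env d lam Lam r) (g : Space d → Space d) (hg : ContDiff ℝ 1 g) :
    Env d lam Lam r where
  toFun y := ω.toFun (g y)
  contDiff_entry i j := (ω.contDiff_entry i j).comp hg
  elliptic y := ω.elliptic (g y)
  norm_le y := ω.norm_le (g y)
  le_trace y := ω.le_trace (g y)

/-- Environments that agree on a neighbourhood of a ball of radius `K` are `2^{-K}`-close. -/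
theorem dist_le_of_eventuallyEq {ω η : Env d lam Lam r} {K : ℕ}
    (h : ∀ x : Space d, ‖x‖ ≤ K → ω.toFun =ᶠ[𝓝 x] η.toFun) : dist ω η ≤ (1 / 2) ^ K := by
  set f := ω.toFun - η.toFun with hf
  have hzero : ∀ k < K, c1Norm (k + 1) f = 0 := by
    intro k hk
    refine le_antisymm ?_ (c1Norm_nonneg _ _)
    have := c1Norm_le_of_dist_oneJet_le ω η (K := k + 1) (ε := 0) fun x hx => by
      have hx' : ‖x‖ ≤ K := hx.trans (by exact_mod_cast hk)
      refine (dist_eq_zero.2 ?_).le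
      funext i j
      have he : (fun z => ω.toFun z i j) =ᶠ[𝓝 x] fun z => η.toFun z i j :=
        (h x hx').mono fun z hz => by simp only [hz]
      exact Prod.ext he.self_of_nhds he.fderiv_eq
    simpa using this
  have h1 : dist ω η = ∑' k : ℕ, (1 / 2 ^ (k + 1) : ℝ) *
      (c1Norm (k + 1) f / (1 + c1Norm (k + 1) f)) := rfl
  rw [h1, ← (summable_term f).sum_add_tsum_nat_add K, Finset.sum_eq_zero, zero_add]
  · have hgeom : ∑' k : ℕ, (1 / 2 ^ (k + K + 1) : ℝ) = (1 / 2) ^ K := by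
      have e : ∀ k : ℕ, (1 / 2 ^ (k + K + 1) : ℝ) = (1 / 2) ^ K * (1 / 2) * (1 / 2) ^ k :=
        fun k => by rw [← one_div_pow, pow_succ, pow_add]; ring
      simp only [e]
      rw [tsum_mul_left, tsum_geometric_two]
      ring
    rw [← hgeom]
    refine ((summable_nat_add_iff K).2 (summable_term f)).tsum_le_tsum (fun k => ?_)
      ((summable_nat_add_iff K).2 summable_half)
    exact mul_le_of_le_one_right (by positivity) (frac_le_one (c1Norm_nonneg _ _))
  · intro k hk
    simp [hzero k (Finset.mem_range.1 hk)]

/-- An environment can be made `m`-periodic in such a way that the environment seen from most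
points of a period cube hardly changes. -/
theorem exists_isPeriodic_dist_shift_le (ω : Env d lam Lam r) {m : ℝ} (hm : 0 < m) (K : ℕ) :
    ∃ η : Env d lam Lam r, η.IsPeriodic m ∧
      ∀ y ∈ cube d (m - 4 * (K + 1)), dist (Env.shift y η) (Env.shift y ω) ≤ (1 / 2) ^ K := by
  obtain ⟨h, hC, hper, hid⟩ := exists_periodic_contDiff_eq_id hm (L := K + 1) (by positivity)
  have hg : ContDiff ℝ 1 fun x : Space d => (WithLp.toLp 2 fun i => h (x i) : Space d) :=
    contDiff_euclidean.2 fun i => hC.comp (by fun_prop : ContDiff ℝ 1 fun x : Space d => x i)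
  refine ⟨ω.comp _ hg, fun i => Env.ext (funext fun y => ?_), fun y hy => ?_⟩
  · refine congrArg ω.toFun (congrArg (WithLp.toLp 2) (funext fun j => ?_))
    by_cases hij : j = i
    · subst hij
      simpa [add_comm] using hper (y j)
    · simp [hij]
  · refine dist_le_of_eventuallyEq fun x hx => ?_
    have hnear : ∀ᶠ z in 𝓝 x, ‖z‖ < K + 1 :=
      continuous_norm.continuousAt.eventually_lt_const (by linarith)
    filter_upwards [hnear] with z hz
    refine congrArg ω.toFun (PiLp.ext fun i => hid _ ?_)
    have h1 : |z i| ≤ ‖z‖ := PiLp.norm_apply_le z i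
    have h2 := mem_cube_iff_abs.1 hy i
    calc |(y + z) i| ≤ |y i| + |z i| := abs_add_le _ _
      _ ≤ m / 2 - (K + 1) := by linarith

end Periodization

/-! ### Approximation of the law -/

section Approximation

variable {d : ℕ} {lam Lam r : ℝ}

theorem integral_empiricalMeasure (m : ℝ) (ω : Env d lam Lam r) {F : Env d lam Lam r → ℝ}
    (hF : Measurable F) : ∫ η, F η ∂empiricalMeasure m ω = cubeAverage d m F ω :=
  integral_map (continuous_shift ω).measurable.aemeasurable hF.aestronglyMeasurable

/-- The weak topology is generated by finitely many integrals at a time. -/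
theorem exists_finset_of_mem_nhds {Ω : Type*} [MeasurableSpace Ω] [TopologicalSpace Ω]
    [OpensMeasurableSpace Ω] {μ : ProbabilityMeasure Ω} {U : Set (ProbabilityMeasure Ω)}
    (hU : U ∈ 𝓝 μ) : ∃ (S : Finset (BoundedContinuousFunction Ω ℝ)) (ε : ℝ), 0 < ε ∧
      ∀ ν : ProbabilityMeasure Ω,
        (∀ F ∈ S, |∫ x, F x ∂(ν : Measure Ω) - ∫ x, F x ∂(μ : Measure Ω)| < ε) → ν ∈ U := by
  set e : ProbabilityMeasure Ω → BoundedContinuousFunction Ω ℝ → ℝ :=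
    fun ν F => ∫ x, F x ∂(ν : Measure Ω) with he
  have hle : comap e (𝓝 (e μ)) ≤ 𝓝 μ := by
    have h : Tendsto id (comap e (𝓝 (e μ))) (𝓝 μ) :=
      ProbabilityMeasure.tendsto_iff_forall_integral_tendsto.2
        (tendsto_pi_nhds.1 (tendsto_comap : Tendsto e _ (𝓝 (e μ))))
    exact h
  obtain ⟨V, hV, hVU⟩ := hle hU
  rw [nhds_pi, mem_pi] at hV
  obtain ⟨I, hI, t, ht, htV⟩ := hV
  have hball : ∀ F, ∃ ε > 0, Metric.ball (e μ F) ε ⊆ t F := fun F => Metric.mem_nhds_iff.1 (ht F)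
  choose ε hε hεt using hball
  obtain ⟨δ, hδ, hδε⟩ : ∃ δ : ℝ, 0 < δ ∧ ∀ F ∈ hI.toFinset, δ ≤ ε F := by
    rcases hI.toFinset.eq_empty_or_nonempty with h | h
    · exact ⟨1, one_pos, by simp [h]⟩
    · exact ⟨hI.toFinset.inf' h ε, (Finset.lt_inf'_iff h).2 fun F _ => hε F,
        fun F hF => Finset.inf'_le ε hF⟩
  refine ⟨hI.toFinset, δ, hδ, fun ν hν => hVU (htV fun F hF => hεt F ?_)⟩
  have hF' : F ∈ hI.toFinset := hI.mem_toFinset.2 hF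
  rw [Metric.mem_ball, Real.dist_eq]
  exact (hν F hF').trans_le (hδε F hF')

/-- For large `m`, some environment has an empirical measure on the cube of side `m` in a given
weak neighbourhood of `μ`: by the mean ergodic theorem most environments do. -/
theorem eventually_exists_empiricalMeasure_mem {μ : ProbabilityMeasure (Env d lam Lam r)}
    (hinv : IsShiftInvariant (μ : Measure (Env d lam Lam r)))
    (herg : IsShiftErgodic (μ : Measure (Env d lam Lam r)))
    {U : Set (ProbabilityMeasure (Env d lam Lam r))} (hU : U ∈ 𝓝 μ) :
    ∀ᶠ m : ℝ in atTop, ∃ (ω : Env d lam Lam r)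
      (h : IsProbabilityMeasure (empiricalMeasure m ω)), (⟨empiricalMeasure m ω, h⟩ :
        ProbabilityMeasure (Env d lam Lam r)) ∈ U := by
  obtain ⟨S, ε, hε, hS⟩ := exists_finset_of_mem_nhds hU
  have := ergodicVAdd hinv herg
  have hlim : Tendsto (fun m => ∑ F ∈ S, ∫⁻ ω, ‖cubeAverage d m F ω - ∫ η, F η ∂(μ : Measure _)‖ₑ
      ∂(μ : Measure (Env d lam Lam r))) atTop (𝓝 0) := by
    rw [← Finset.sum_const_zero (s := S)]
    exact tendsto_finsetSum _ fun F _ => tendsto_lintegral_enorm_cubeAverage_sub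
      F.continuous.measurable (C := ‖F‖) fun ω => F.norm_coe_le_norm ω
  filter_upwards [hlim.eventually_lt_const (ENNReal.ofReal_pos.2 hε), eventually_gt_atTop 0]
    with m hm hm0
  have hmeas : ∀ F : BoundedContinuousFunction (Env d lam Lam r) ℝ, Measurable fun ω =>
      ‖cubeAverage d m F ω - ∫ η, F η ∂(μ : Measure _)‖ₑ := fun F =>
    ((measurable_cubeAverage F.continuous.measurable).sub_const _).enorm
  rw [← lintegral_finsetSum _ fun F _ => hmeas F] at hm
  obtain ⟨ω, hω⟩ := exists_le_lintegral (μ := (μ : Measure (Env d lam Lam r)))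
    (Finset.measurable_fun_sum S fun F _ => hmeas F).aemeasurable
  refine ⟨ω, isProbabilityMeasure_empiricalMeasure hm0 ω, hS _ fun F hF => ?_⟩
  have h1 : ‖cubeAverage d m F ω - ∫ η, F η ∂(μ : Measure _)‖ₑ < ENNReal.ofReal ε :=
    (Finset.single_le_sum (f := fun F : BoundedContinuousFunction (Env d lam Lam r) ℝ =>
      ‖cubeAverage d m F ω - ∫ η, F η ∂(μ : Measure _)‖ₑ) (fun _ _ => zero_le) hF).trans_lt
      (hω.trans_lt hm)
  rw [Real.enorm_eq_ofReal_abs, ENNReal.ofReal_lt_ofReal_iff hε] at h1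
  rw [← integral_empiricalMeasure m ω F.continuous.measurable] at h1
  exact h1

/-- The effect on orbit averages of a modification that is small along most of the orbit. -/
theorem abs_cubeAverage_sub_le {m c : ℝ} (hm : 0 < m) {ω η : Env d lam Lam r} {δ : ℝ}
    (hδ : 0 ≤ δ)
    (h : ∀ y ∈ cube d (m - c), dist (Env.shift y η) (Env.shift y ω) ≤ δ)
    {F : Env d lam Lam r → ℝ} {C : ℝ} (hC : ∀ x y, dist (F x) (F y) ≤ C) {L : NNReal}
    (hL : LipschitzWith L F) :
    |cubeAverage d m F η - cubeAverage d m F ω| ≤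
      L * δ + C * (cubeMeasure d m).real (cube d (m - c))ᶜ := by
  have := isProbabilityMeasure_cubeMeasure (d := d) hm
  have hC' : ∀ x, |F x| ≤ |F ω| + C := fun x => by
    have := abs_sub_abs_le_abs_sub (F x) (F ω)
    have := hC x ω
    rw [Real.dist_eq] at this
    linarith
  have hi := fun ω : Env d lam Lam r =>
    integrable_comp_vadd (d := d) (m := m) hL.continuous.measurable hC' ω
  have hsub : Integrable (fun y : Space d => F (y +ᵥ η) - F (y +ᵥ ω)) (cubeMeasure d m) :=
    (hi η).sub (hi ω)
  rw [cubeAverage, cubeAverage, ← integral_sub (hi η) (hi ω),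
    ← integral_add_compl measurableSet_cube hsub]
  refine (abs_add_le _ _).trans (add_le_add ?_ ?_)
  · have h1 := norm_setIntegral_le_of_norm_le_const (μ := cubeMeasure d m)
      (s := cube d (m - c)) (f := fun y => F (y +ᵥ η) - F (y +ᵥ ω)) (C := L * δ)
      (measure_lt_top _ _) fun y hy => by
        rw [← dist_eq_norm]
        exact (hL.dist_le_mul _ _).trans (mul_le_mul_of_nonneg_left (h y hy) L.2)
    exact h1.trans (mul_le_of_le_one_right (by positivity) measureReal_le_one)
  · exact norm_setIntegral_le_of_norm_le_const (μ := cubeMeasure d m) (s := (cube d (m - c))ᶜ)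
      (f := fun y => F (y +ᵥ η) - F (y +ᵥ ω)) (measure_lt_top _ _) fun y _ => hC _ _

end Approximation

end StableLike

theorem theorem3p3 (d : ℕ) (lam Lam r : ℝ) (hlam : 0 < lam) (hLam : 0 < Lam) (hr : 0 < r)
    (μ : MeasureTheory.Measure (StableLike.Env d lam Lam r))
    (hprob : MeasureTheory.IsProbabilityMeasure μ)
    (hinv : StableLike.IsShiftInvariant μ) (herg : StableLike.IsShiftErgodic μ) :
    ∃ (ω : ℕ → StableLike.Env d lam Lam r) (M : ℕ → ℝ),
      (∀ n, 0 < M n) ∧ StrictMono M ∧ Filter.Tendsto M Filter.atTop Filter.atTop ∧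
      (∀ n, (ω n).IsPeriodic (M n)) ∧
      (∀ n, MeasureTheory.IsProbabilityMeasure (StableLike.empiricalMeasure (M n) (ω n))) ∧
      ∀ F : BoundedContinuousFunction (StableLike.Env d lam Lam r) ℝ,
        Filter.Tendsto
          (fun n => ∫ η, F η ∂(StableLike.empiricalMeasure (M n) (ω n)))
          Filter.atTop (nhds (∫ η, F η ∂μ)) := by
  open StableLike in
  let μ' : ProbabilityMeasure (Env d lam Lam r) := ⟨μ, hprob⟩
  obtain ⟨U, hU⟩ := (𝓝 μ').exists_antitone_basis
  -- The boundary layer of width `4 (n + 1)` has to be negligible in the cube of side `M n`.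
  have hev : ∀ n : ℕ, ∀ᶠ m : ℕ in atTop, 0 < (m : ℝ) ∧
      (cubeMeasure d m).real (cube d (m - 4 * (n + 1)))ᶜ < 1 / ((n : ℝ) + 1) ∧
      ∃ (ω : Env d lam Lam r) (h : IsProbabilityMeasure (empiricalMeasure m ω)),
        (⟨empiricalMeasure m ω, h⟩ : ProbabilityMeasure (Env d lam Lam r)) ∈ U n := fun n =>
    tendsto_natCast_atTop_atTop.eventually ((eventually_gt_atTop 0).and
      (((tendsto_cubeMeasure_compl (c := 4 * ((n : ℝ) + 1)) (by positivity)).eventually_lt_const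
        (by positivity)).and
        (eventually_exists_empiricalMeasure_mem (μ := μ') hinv herg (hU.1.mem_of_mem trivial))))
  obtain ⟨φ, hφ, hP⟩ := extraction_forall_of_eventually hev
  choose hpos hlayer ω hω hωU using hP
  choose η hper hdist using fun n => exists_isPeriodic_dist_shift_le (ω n) (hpos n) n
  have hη : ∀ n, IsProbabilityMeasure (empiricalMeasure (φ n : ℝ) (η n)) := fun n =>
    isProbabilityMeasure_empiricalMeasure (hpos n) (η n)
  refine ⟨η, fun n => φ n, hpos, Nat.strictMono_cast.comp hφ,
    tendsto_natCast_atTop_atTop.comp hφ.tendsto_atTop, hper, hη, ?_⟩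
  let νω : ℕ → ProbabilityMeasure (Env d lam Lam r) := fun n => ⟨_, hω n⟩
  let νη : ℕ → ProbabilityMeasure (Env d lam Lam r) := fun n => ⟨_, hη n⟩
  have hconv : Tendsto νω atTop (𝓝 μ') := hU.tendsto hωU
  have hconv' : Tendsto νη atTop (𝓝 μ') := by
    rw [tendsto_iff_forall_lipschitz_integral_tendsto] at hconv ⊢
    rintro F ⟨C, hC⟩ ⟨L, hL⟩
    have hF := hconv F ⟨C, hC⟩ ⟨L, hL⟩
    have hC0 : 0 ≤ C := dist_nonneg.trans (hC (ω 0) (ω 0))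
    have herr : Tendsto (fun n : ℕ => L * (1 / 2 : ℝ) ^ n + C * (1 / ((n : ℝ) + 1))) atTop
        (𝓝 0) := by
      have h1 := (tendsto_pow_atTop_nhds_zero_of_lt_one (r := (1 / 2 : ℝ)) (by norm_num)
        (by norm_num)).const_mul (L : ℝ)
      have h2 := (tendsto_one_div_add_atTop_nhds_zero_nat (𝕜 := ℝ)).const_mul C
      simpa using h1.add h2
    have hdiff : Tendsto (fun n => ∫ ζ, F ζ ∂empiricalMeasure (φ n) (η n) -
        ∫ ζ, F ζ ∂empiricalMeasure (φ n) (ω n)) atTop (𝓝 0) := by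
      refine squeeze_zero_norm (fun n => ?_) herr
      rw [integral_empiricalMeasure _ _ hL.continuous.measurable,
        integral_empiricalMeasure _ _ hL.continuous.measurable, Real.norm_eq_abs]
      refine (abs_cubeAverage_sub_le (hpos n) (by positivity) (hdist n) hC hL).trans ?_
      gcongr
      exact (hlayer n).le
    have h := hdiff.add hF
    rw [zero_add] at h
    exact h.congr fun n => sub_add_cancel _ _
  exact ProbabilityMeasure.tendsto_iff_forall_integral_tendsto.1 hconv'
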